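/- Let $T,D,a\in\mathbb R$ with $a^2+D^2\neq 0$, and consider the planar system $\dot x=Tx-y$, $\dot y=Dx-a$. Let $y_0\ge 0$, let $\Psi=(\Psi_1,\Psi_2):\mathbb R\to\mathbb R^2$ be the solution with $\Psi(0)=(0,y_0)$, and assume that the left Poincaré half-map $P$ associated with $\Sigma=\{x=0\}$ is defined at $y_0$ by an actual return, i.e. there is $\tau>0$ with $\Psi_1(\tau)=0$ and $\Psi_1(t)<0$ for all $t\in(0,\tau)$. Put $y_1=P(y_0)=\Psi_2(\tau)$. Let $$V(x,y)=D^2x^2-DTxy+Dy^2+a(T^2-2D)x-aTy+a^2,$$ and let $\Gamma=\{(0,y):y_1<y<y_0\}\cup\{\Psi(t):0\le t\le\tau\}$, with $\operatorname{Int}(\Gamma)$ the interior of this Jordan curve (the points off $\Gamma$ lying in a bounded component of its complement). Consider the scenarios - $(S_0)$: $\Gamma\cup\operatorname{Int}(\Gamma)$ contains no equilibrium of the system; - $(S_1)$: the origin is an equilibrium; - $(S_2)$: some equilibrium lies in $\operatorname{Int}(\Gamma)$. Then exactly one of $(S_0),(S_1),(S_2)$ holds. If $(S_k)$ holds, then $y_1\le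 0\le y_0$, the function $y\mapsto -y/V(0,y)$ is continuous on $[y_1,y_0]\setminus\{0\}$, and the Cauchy principal value at $0$ exists and satisfies $$\operatorname{PV}\int_{y_1}^{y_0}\frac{-y}{V(0,y)}\,dy=d_k,\qquad d_0=0,\qquad d_k=\frac{k\pi T}{D\sqrt{4D-T^2}}\quad(k=1,2),$$ where moreover $4D-T^2>0$ (so $D>0$) if $k\in\{1,2\}$. Here, for $\xi_1<0<\xi_2$, $\operatorname{PV}\int_{\xi_1}^{\xi_2}h=\lim_{\varepsilon\searrow0}\left(\int_{\xi_1}^{-\varepsilon}h+\int_{\varepsilon}^{\xi_2}h\right)$; if $\xi_1=0$ or $\xi_2=0$, the integral over the corresponding (empty) side is taken to be $0$. -/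

import Mathlib

open Set Filter Topology

namespace LienardHalfMap

noncomputable section

/-- The vector field `L(x,y) = (T x - y, D x - a)` of the Liénard system. -/
def field (T D a : ℝ) (p : ℝ × ℝ) : ℝ × ℝ := (T * p.1 - p.2, D * p.1 - a)

/-- `p` is an equilibrium point of the Liénard system. -/
def IsEquilibrium (T D a : ℝ) (p : ℝ × ℝ) : Prop := field T D a p = 0

/-- The inverse integrating factor
`V(x,y) = D² x² - D T x y + D y² + a (T² - 2 D) x - a T y + a²`. -/
def V (T D a x y : ℝ) : ℝ :=
  D ^ 2 * x ^ 2 - D * T * x * y + D * y ^ 2 + a * (T ^ 2 - 2 * D) * x - a * T * y + a ^ 2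

/-- `y₁` is the image of `y₀ ≥ 0` by the left Poincaré half-map associated to `{x = 0}`, with
left flight time `τ`, where `Ψ` is the (unique, globally defined) orbit issuing from `(0, y₀)`. -/
structure IsLeftPoincareImage (T D a y₀ y₁ τ : ℝ) (Ψ : ℝ → ℝ × ℝ) : Prop where
  start_nonneg : 0 ≤ y₀
  orbit : ∀ t : ℝ, HasDerivAt Ψ (field T D a (Ψ t)) t
  start : Ψ 0 = (0, y₀)
  time_pos : 0 < τ
  left : ∀ t ∈ Ioo 0 τ, (Ψ t).1 < 0
  return_eq : Ψ τ = (0, y₁)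

/-- The curve `Γ = Γ₁ ∪ Γ₂`: the open segment of `{x = 0}` between `(0, y₁)` and `(0, y₀)`
together with the closed piece of orbit from `(0, y₀)` to `(0, y₁)`. -/
def Gam (y₀ y₁ τ : ℝ) (Ψ : ℝ → ℝ × ℝ) : Set (ℝ × ℝ) :=
  (fun y : ℝ => ((0 : ℝ), y)) '' Ioo y₁ y₀ ∪ Ψ '' Icc 0 τ

/-- The interior of a Jordan curve `C`: the points off `C` whose connected component in the
complement of `C` is bounded. -/
def jordanInt (C : Set (ℝ × ℝ)) : Set (ℝ × ℝ) :=
  {p | p ∉ C ∧ Bornology.IsBounded (connectedComponentIn Cᶜ p)}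

/-- The scenarios `(S₀)`, `(S₁)`, `(S₂)`. -/
def Scenario (T D a y₀ y₁ τ : ℝ) (Ψ : ℝ → ℝ × ℝ) : Fin 3 → Prop
  | 0 => ∀ p ∈ Gam y₀ y₁ τ Ψ ∪ jordanInt (Gam y₀ y₁ τ Ψ), ¬ IsEquilibrium T D a p
  | 1 => IsEquilibrium T D a (0, 0)
  | 2 => ∃ p ∈ jordanInt (Gam y₀ y₁ τ Ψ), IsEquilibrium T D a p

/-- The constants `d₀ = 0` and `d_k = k π T / (D √(4 D - T²))` for `k = 1, 2`. -/
def d (T D : ℝ) (k : Fin 3) : ℝ :=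
  if k = 0 then 0 else ((k : ℕ) : ℝ) * Real.pi * T / (D * Real.sqrt (4 * D - T ^ 2))

/-- The Cauchy principal value at zero of `∫_{ξ₁}^{ξ₂} h`, for `ξ₁ ≤ 0 ≤ ξ₂` and `h` continuous on
`[ξ₁, ξ₂] \ {0}`, exists and equals `l`. If `ξ₁ < 0 < ξ₂`, then for small `ε > 0` the two integrals
are those over `[ξ₁, -ε]` and `[ε, ξ₂]`; if an endpoint is zero, the integral on that (empty)
side is zero. -/
def HasPV (h : ℝ → ℝ) (ξ₁ ξ₂ l : ℝ) : Prop :=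
  ξ₁ ≤ 0 ∧ 0 ≤ ξ₂ ∧ ContinuousOn h (Icc ξ₁ ξ₂ \ {0}) ∧
    Tendsto (fun ε : ℝ => (∫ y in ξ₁..(max ξ₁ (-ε)), h y) + ∫ y in (min ξ₂ ε)..ξ₂, h y)
      (𝓝[>] 0) (𝓝 l)

end

end LienardHalfMap

namespace LienardHalfMap

open Real Bornology

/-! ### Topology of star-shaped curves -/

/-! The velocity `(u, w) = (Tx - y, Dx - a)` of the orbit solves a homogeneous linear system, and `V
= w² - T u w + D u²`, so `V` grows like `exp (T t)` along the orbit (`V_eq_mul_exp`). The scenarios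
are separated by whether `a = 0` and, if not, by whether `w` vanishes on the arc.

If `a ≠ 0` and `w` never vanishes, then `η = a u / w` runs from `y₀` to `y₁` and `η' = -V(0, η)/a`.
The substitution `y = η(t)` turns the integrand into a multiple of `dx / (Dx - a)`, integrated from
`x = 0` back to `x = 0`, which gives zero. The line `Dx = a` misses `Γ`, so no equilibrium is
enclosed.

Otherwise real eigenvalues are impossible: each real eigenvalue gives a linear form in the velocity
that keeps its sign, against the return (`disc_pos_of_zero`, `disc_pos_of_crossing`). In suitable
linear coordinates the orbit is a spiral with angular speed `ω = √(4D - T²)/2` and growth rate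
`T/2`. For `a = 0` the flight is exactly half a turn. For `a < 0` a primitive of `-y / V(0, y)`
combines `log V`, which contributes `T τ`, with the angle on the section, and their sum is one full
turn. That same turn makes `Γ` a polar graph around the focus, which therefore lies inside. -/

theorem isBounded_connectedComponentIn_of_star {E : Type*} [NormedAddCommGroup E]
    [NormedSpace ℝ E] {S : Set E} {c : E} (hS : IsCompact S) (hne : S.Nonempty) (hc : c ∉ S)
    (hex : ∀ v : E, v ≠ 0 → ∃ s : ℝ, 0 < s ∧ c + s • v ∈ S)
    (huniq : ∀ (v : E) (s : ℝ), 0 < s → c + v ∈ S → c + s • v ∈ S → s = 1) :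
    IsBounded (connectedComponentIn Sᶜ c) := by
  -- `K` is the filled region and `F` the set of points on or behind `S` as seen from `c`. Rays
  -- meeting `S` give `F ∪ K = E`; meeting it only once gives `F ∩ K ⊆ S`. So the complements of `F`
  -- and `K` separate the complement of `S`, and the part containing `c` lies in the compact set
  -- `K`.
  set K : Set E := (fun p : ℝ × E => c + p.1 • (p.2 - c)) '' (Icc 0 1 ×ˢ S) with hK
  set F : Set E := {p | ∃ s ∈ Icc (0 : ℝ) 1, c + s • (p - c) ∈ S} with hF
  have hKc : IsCompact K := (isCompact_Icc.prod hS).image (by fun_prop)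
  have hFc : IsClosed F := by
    have h : IsClosed {q : Icc (0 : ℝ) 1 × E | c + (q.1 : ℝ) • (q.2 - c) ∈ S} :=
      hS.isClosed.preimage (by fun_prop)
    have h' := isClosedMap_snd_of_compactSpace _ h
    convert h' using 1
    ext p
    simp [hF]
  have hcF : c ∈ Fᶜ := by
    rintro ⟨s, -, hs⟩
    simp [hc] at hs
  have hdisj : Disjoint Fᶜ Kᶜ := by
    rw [disjoint_compl_left_iff_subset]
    intro p hp
    by_contra hpF
    apply hp
    rcases eq_or_ne p c with rfl | hpc
    · obtain ⟨q, hq⟩ := hne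
      exact ⟨(0, q), ⟨⟨le_rfl, zero_le_one⟩, hq⟩, by simp⟩
    · obtain ⟨s, hs, hsS⟩ := hex (p - c) (sub_ne_zero.2 hpc)
      rcases le_total s 1 with h1 | h1
      · exact absurd ⟨s, ⟨hs.le, h1⟩, hsS⟩ hpF
      · refine ⟨(s⁻¹, c + s • (p - c)), ⟨⟨by positivity, inv_le_one_of_one_le₀ h1⟩, hsS⟩, ?_⟩
        simp [smul_smul, inv_mul_cancel₀ hs.ne']
  have hcover : connectedComponentIn Sᶜ c ⊆ Fᶜ ∪ Kᶜ := by
    intro p hp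
    have hpS : p ∉ S := connectedComponentIn_subset _ _ hp
    by_contra h
    simp only [mem_union, mem_compl_iff, not_or, not_not] at h
    obtain ⟨⟨s, hs, hsS⟩, ⟨⟨r, q⟩, ⟨hr, hq⟩, rfl⟩⟩ := h
    simp only [add_sub_cancel_left, smul_smul] at hsS hr hq hpS
    have hs0 : s ≠ 0 := by rintro rfl; simp [hc] at hsS
    have hr0 : r ≠ 0 := by rintro rfl; simp [hc] at hsS
    have hsp : 0 < s := lt_of_le_of_ne hs.1 hs0.symm
    have hrp : 0 < r := lt_of_le_of_ne hr.1 hr0.symm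
    have h1 := huniq (q - c) (s * r) (by positivity) (by simpa using hq) hsS
    have hr1 : r = 1 := by nlinarith [hs.2, hr.2]
    subst hr1
    simp [hq] at hpS
  have hsub := isPreconnected_connectedComponentIn.subset_left_of_subset_union hFc.isOpen_compl
    hKc.isClosed.isOpen_compl hdisj hcover
    ⟨c, mem_connectedComponentIn hc, hcF⟩
  exact hKc.isBounded.subset fun p hp =>
    not_not.1 fun h => disjoint_left.1 hdisj (hsub hp) h

theorem exists_int_of_cos_sin_eq {φ ψ : ℝ} (hc : cos φ = cos ψ) (hs : sin φ = sin ψ) :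
    ∃ k : ℤ, φ - ψ = k * (2 * π) := by
  have h : cos (φ - ψ) = 1 := by
    rw [cos_sub, hc, hs]; nlinarith [sin_sq_add_cos_sq ψ]
  obtain ⟨k, hk⟩ := (cos_eq_one_iff _).1 h
  exact ⟨k, hk.symm⟩

theorem exists_polar (α P Q : ℝ) :
    ∃ R φ : ℝ, 0 ≤ R ∧ φ ∈ Ico α (α + 2 * π) ∧ P = R * cos φ ∧ Q = R * sin φ := by
  set z : ℂ := ⟨P, Q⟩
  refine ⟨‖z‖, toIcoMod two_pi_pos α z.arg, norm_nonneg _, toIcoMod_mem_Ico _ _ _, ?_, ?_⟩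
  · rw [toIcoMod, zsmul_eq_mul, cos_sub_int_mul_two_pi, Complex.norm_mul_cos_arg]
  · rw [toIcoMod, zsmul_eq_mul, sin_sub_int_mul_two_pi, Complex.norm_mul_sin_arg]

/-- A closed polar graph with positive radius meets each ray exactly once. The sheared coordinates
are those in which a focus becomes a logarithmic spiral. -/
theorem isBounded_connectedComponentIn_of_polar_graph {S : Set (ℝ × ℝ)} {c : ℝ × ℝ}
    {ω m α : ℝ} {g : ℝ → ℝ} (hω : 0 < ω) (hS : IsCompact S) (hne : S.Nonempty)
    (hg : ∀ φ ∈ Icc α (α + 2 * π), 0 < g φ) (hper : g α = g (α + 2 * π))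
    (hmem : ∀ v : ℝ × ℝ, c + v ∈ S ↔ ∃ φ ∈ Icc α (α + 2 * π),
      ω * v.1 = g φ * cos φ ∧ v.2 - m * v.1 = g φ * sin φ) :
    c ∉ S ∧ IsBounded (connectedComponentIn Sᶜ c) := by
  have hc : c ∉ S := by
    intro h
    obtain ⟨φ, hφ, h1, h2⟩ := (hmem 0).1 (by simpa using h)
    have := hg φ hφ
    simp only [Prod.fst_zero, mul_zero, Prod.snd_zero, sub_zero] at h1 h2
    nlinarith [sin_sq_add_cos_sq φ, mul_pos this this, (mul_eq_zero.1 h1.symm).resolve_left this.ne',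
      (mul_eq_zero.1 h2.symm).resolve_left this.ne']
  refine ⟨hc, isBounded_connectedComponentIn_of_star hS hne hc ?_ ?_⟩
  · intro v hv
    obtain ⟨R, φ, hR, hφ, hP, hQ⟩ := exists_polar α (ω * v.1) (v.2 - m * v.1)
    have hR0 : R ≠ 0 := by
      rintro rfl
      simp only [zero_mul, mul_eq_zero, hω.ne', false_or] at hP hQ
      simp only [hP, mul_zero, sub_zero] at hQ
      exact hv (Prod.ext hP hQ)
    have hRp : 0 < R := lt_of_le_of_ne hR hR0.symm
    have hgp := hg φ (Ico_subset_Icc_self hφ)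
    refine ⟨g φ / R, by positivity, (hmem _).2 ⟨φ, Ico_subset_Icc_self hφ, ?_, ?_⟩⟩
    · simp only [Prod.smul_fst, smul_eq_mul]
      rw [mul_left_comm, hP]; field_simp
    · simp only [Prod.smul_fst, Prod.smul_snd, smul_eq_mul]
      rw [mul_left_comm, ← mul_sub, hQ]; field_simp
  · intro v s hs h1 h2
    obtain ⟨φ, hφ, hP, hQ⟩ := (hmem _).1 h1
    obtain ⟨ψ, hψ, hP', hQ'⟩ := (hmem _).1 h2
    simp only [Prod.smul_fst, Prod.smul_snd, smul_eq_mul] at hP' hQ'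
    rw [mul_left_comm, hP] at hP'
    rw [mul_left_comm, ← mul_sub, hQ] at hQ'
    have hgφ := hg φ hφ
    have hgψ := hg ψ hψ
    have hsg : s * g φ = g ψ := by
      have h : (s * g φ) ^ 2 = (g ψ) ^ 2 := by
        have e1 : (s * g φ) ^ 2 = (s * (g φ * cos φ)) ^ 2 + (s * (g φ * sin φ)) ^ 2 := by
          linear_combination (-(s * g φ) ^ 2) * sin_sq_add_cos_sq φ
        rw [e1, hP', hQ']
        linear_combination (g ψ) ^ 2 * sin_sq_add_cos_sq ψ
      exact (pow_left_inj₀ (by positivity) hgψ.le two_ne_zero).1 h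
    have hcos : cos φ = cos ψ := mul_left_cancel₀ hgψ.ne' (by rw [← hP', ← hsg]; ring)
    have hsin : sin φ = sin ψ := mul_left_cancel₀ hgψ.ne' (by rw [← hQ', ← hsg]; ring)
    obtain ⟨k, hk⟩ := exists_int_of_cos_sin_eq hcos hsin
    -- Angles in one closed period that agree mod `2π` coincide or are its two endpoints, where
    -- `hper` applies.
    have hgg : g φ = g ψ := by
      have hpi := two_pi_pos
      have hk1 : k ≤ 1 := by
        have : (k : ℝ) ≤ 1 := le_of_mul_le_mul_right (by linarith [hφ.2, hψ.1]) hpi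
        exact_mod_cast this
      have hk2 : -1 ≤ k := by
        have : (-1 : ℝ) ≤ k := le_of_mul_le_mul_right (by linarith [hφ.1, hψ.2]) hpi
        exact_mod_cast this
      have : k = -1 ∨ k = 0 ∨ k = 1 := by omega
      rcases this with rfl | rfl | rfl
      · have e1 : φ = α := by push_cast at hk; linarith [hφ.1, hψ.2]
        have e2 : ψ = α + 2 * π := by push_cast at hk; linarith [hφ.1, hψ.2]
        rw [e1, e2, hper]
      · have e1 : φ = ψ := by push_cast at hk; linarith
        rw [e1]
      · have e1 : ψ = α := by push_cast at hk; linarith [hφ.2, hψ.1]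
        have e2 : φ = α + 2 * π := by push_cast at hk; linarith [hφ.2, hψ.1]
        rw [e1, e2, hper]
    rw [← hgg] at hsg
    exact mul_right_cancel₀ hgφ.ne' (by rw [hsg, one_mul])

/-! ### Linear differential equations -/

theorem eq_mul_exp {f : ℝ → ℝ} {k : ℝ} (hf : ∀ t, HasDerivAt f (k * f t) t) (t : ℝ) :
    f t = f 0 * exp (k * t) := by
  have hg : ∀ s, HasDerivAt (fun s => f s * exp (-(k * s))) 0 s := by
    intro s
    have he : HasDerivAt (fun s => exp (-(k * s))) (exp (-(k * s)) * -(k * 1)) s :=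
      ((hasDerivAt_id s).const_mul k).neg.exp
    exact ((hf s).mul he).congr_deriv (by ring)
  have h := is_const_of_deriv_eq_zero (fun s => (hg s).differentiableAt) (fun s => (hg s).deriv) t 0
  simp only [mul_zero, neg_zero, exp_zero, mul_one] at h
  rw [← h, mul_assoc, ← exp_add, neg_add_cancel, exp_zero, mul_one]

/-- The squared distance `E` to the explicit spiral satisfies `E' = 2 μ E` and `E 0 = 0`, hence
vanishes. -/
theorem spiral_eq {P Q : ℝ → ℝ} {μ ω ρ θ : ℝ}
    (hP : ∀ t, HasDerivAt P (μ * P t - ω * Q t) t) (hQ : ∀ t, HasDerivAt Q (ω * P t + μ * Q t) t)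
    (hP0 : P 0 = ρ * cos θ) (hQ0 : Q 0 = ρ * sin θ) (t : ℝ) :
    P t = ρ * exp (μ * t) * cos (θ + ω * t) ∧ Q t = ρ * exp (μ * t) * sin (θ + ω * t) := by
  have he : ∀ s, HasDerivAt (fun s => ρ * exp (μ * s)) (μ * (ρ * exp (μ * s))) s := fun s =>
    (((hasDerivAt_id s).const_mul μ).exp.const_mul ρ).congr_deriv (by simp only [id]; ring)
  have ha : ∀ s, HasDerivAt (fun s => θ + ω * s) ω s := fun s =>
    (((hasDerivAt_id s).const_mul ω).const_add θ).congr_deriv (by ring)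
  have hA : ∀ s, HasDerivAt (fun s => P s - ρ * exp (μ * s) * cos (θ + ω * s)) _ s :=
    fun s => (hP s).sub ((he s).mul (ha s).cos)
  have hB : ∀ s, HasDerivAt (fun s => Q s - ρ * exp (μ * s) * sin (θ + ω * s)) _ s :=
    fun s => (hQ s).sub ((he s).mul (ha s).sin)
  have hE := eq_mul_exp (k := 2 * μ) (f := fun s => (P s - ρ * exp (μ * s) * cos (θ + ω * s)) ^ 2 +
      (Q s - ρ * exp (μ * s) * sin (θ + ω * s)) ^ 2)
    (fun s => (((hA s).pow 2).add ((hB s).pow 2)).congr_deriv (by push_cast; ring)) t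
  simp only [mul_zero, exp_zero, mul_one, add_zero, hP0, hQ0, sub_self] at hE
  have h1 := sq_nonneg (P t - ρ * exp (μ * t) * cos (θ + ω * t))
  have h2 := sq_nonneg (Q t - ρ * exp (μ * t) * sin (θ + ω * t))
  norm_num at hE
  exact ⟨sub_eq_zero.1 (pow_eq_zero_iff two_ne_zero |>.1 (by linarith)),
    sub_eq_zero.1 (pow_eq_zero_iff two_ne_zero |>.1 (by linarith))⟩

theorem deriv_nonneg_of_neg_left {f : ℝ → ℝ} {f' τ : ℝ} (hτ : 0 < τ) (hf : HasDerivAt f f' τ)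
    (h0 : f τ = 0) (hneg : ∀ t ∈ Ioo 0 τ, f t < 0) : 0 ≤ f' := by
  have h := (hasDerivAt_iff_tendsto_slope_left_right.1 hf).1
  refine ge_of_tendsto h ?_
  filter_upwards [Ioo_mem_nhdsLT hτ] with t ht
  rw [slope_def_field, h0]
  exact div_nonneg_of_nonpos (by linarith [hneg t ht]) (by linarith [ht.2])

/-! ### Principal values -/

theorem hasPV_of_continuousOn {h : ℝ → ℝ} {ξ₁ ξ₂ : ℝ} (h₁ : ξ₁ ≤ 0) (h₂ : 0 ≤ ξ₂)
    (hc : ContinuousOn h (Icc ξ₁ ξ₂)) : HasPV h ξ₁ ξ₂ (∫ y in ξ₁..ξ₂, h y) := by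
  refine ⟨h₁, h₂, hc.mono sdiff_subset, ?_⟩
  have h12 := h₁.trans h₂
  have hint : MeasureTheory.IntegrableOn h (uIcc ξ₁ ξ₂) := by
    rw [uIcc_of_le h12]; exact hc.integrableOn_Icc
  have hF : ContinuousOn (fun x => ∫ y in ξ₁..x, h y) (Icc ξ₁ ξ₂) := by
    rw [← uIcc_of_le h12]; exact intervalIntegral.continuousOn_primitive_interval hint
  have hI : ∀ a ∈ Icc ξ₁ ξ₂, ∀ b ∈ Icc ξ₁ ξ₂, IntervalIntegrable h MeasureTheory.volume a b :=
    fun a ha b hb => (hc.mono ((uIcc_subset_Icc ha hb))).intervalIntegrable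
  -- The truncation keeps the cut points in the interval, so a zero endpoint needs no separate case.
  have t1 : Tendsto (fun ε : ℝ => max ξ₁ (-ε)) (𝓝[>] 0) (𝓝[Icc ξ₁ ξ₂] 0) := by
    refine tendsto_nhdsWithin_iff.2 ⟨?_, ?_⟩
    · have : Continuous fun ε : ℝ => max ξ₁ (-ε) := by fun_prop
      simpa [h₁] using (this.tendsto 0).mono_left nhdsWithin_le_nhds
    · filter_upwards [self_mem_nhdsWithin] with ε hε
      exact ⟨le_max_left _ _, max_le h12 (by linarith [mem_Ioi.1 hε])⟩
  have t2 : Tendsto (fun ε : ℝ => min ξ₂ ε) (𝓝[>] 0) (𝓝[Icc ξ₁ ξ₂] 0) := by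
    refine tendsto_nhdsWithin_iff.2 ⟨?_, ?_⟩
    · have : Continuous fun ε : ℝ => min ξ₂ ε := by fun_prop
      simpa [h₂] using (this.tendsto 0).mono_left nhdsWithin_le_nhds
    · filter_upwards [self_mem_nhdsWithin] with ε hε
      exact ⟨le_min h12 (by linarith [mem_Ioi.1 hε]), min_le_left _ _⟩
  have h0 : (0 : ℝ) ∈ Icc ξ₁ ξ₂ := ⟨h₁, h₂⟩
  have l1 := (hF 0 h0).tendsto.comp t1
  have l2 := (hF 0 h0).tendsto.comp t2
  have l3 := l1.add (tendsto_const_nhds (x := ∫ y in ξ₁..ξ₂, h y) |>.sub l2)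
  rw [add_sub_cancel] at l3
  refine l3.congr' ?_
  filter_upwards [(tendsto_nhdsWithin_iff.1 t2).2] with ε hε
  simp only [Function.comp]
  rw [intervalIntegral.integral_interval_sub_left (hI _ ⟨le_rfl, h12⟩ _ ⟨h12, le_rfl⟩)
    (hI _ ⟨le_rfl, h12⟩ _ hε)]

theorem hasPV_inv {D y₁ y₀ : ℝ} (h₁ : y₁ < 0) (h₀ : 0 < y₀) :
    HasPV (fun y => -y / (D * y ^ 2)) y₁ y₀ (D⁻¹ * (log (-y₁) - log y₀)) := by
  -- Division by zero gives `0` on both sides, so the identity holds at `y = 0` and `D = 0` too.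
  have hh : (fun y : ℝ => -y / (D * y ^ 2)) = fun y => -D⁻¹ * y⁻¹ := by
    ext y
    rcases eq_or_ne y 0 with rfl | hy
    · simp
    rcases eq_or_ne D 0 with rfl | hD
    · simp
    field_simp
  rw [hh]
  refine ⟨h₁.le, h₀.le, continuousOn_const.mul (continuousOn_inv₀.mono fun y hy => hy.2), ?_⟩
  refine tendsto_const_nhds.congr' ?_
  filter_upwards [Ioo_mem_nhdsGT h₀, Ioo_mem_nhdsGT (neg_pos.2 h₁)] with ε hε hε'
  rw [max_eq_right (by linarith [hε'.2]), min_eq_right hε.2.le,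
    intervalIntegral.integral_const_mul, intervalIntegral.integral_const_mul,
    integral_inv_of_pos hε.1 h₀, integral_inv_of_neg h₁ (neg_lt_zero.2 hε.1),
    log_div h₀.ne' hε.1.ne', log_div (neg_ne_zero.2 hε.1.ne') h₁.ne, log_neg_eq_log, log_neg_eq_log]
  ring

/-! ### The Liénard system -/

theorem isEquilibrium_iff {T D a : ℝ} {p : ℝ × ℝ} :
    IsEquilibrium T D a p ↔ T * p.1 = p.2 ∧ D * p.1 = a := by
  simp [IsEquilibrium, field, Prod.ext_iff, sub_eq_zero]

theorem isEquilibrium_zero_iff {T D a : ℝ} : IsEquilibrium T D a (0, 0) ↔ a = 0 := by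
  simp [isEquilibrium_iff, eq_comm]

namespace IsLeftPoincareImage

variable {T D a y₀ y₁ τ : ℝ} {Ψ : ℝ → ℝ × ℝ}

theorem hasDerivAt_fst (h : IsLeftPoincareImage T D a y₀ y₁ τ Ψ) (t : ℝ) :
    HasDerivAt (fun t => (Ψ t).1) (T * (Ψ t).1 - (Ψ t).2) t :=
  (hasFDerivAt_fst (𝕜 := ℝ) (p := Ψ t)).comp_hasDerivAt t (h.orbit t)

theorem hasDerivAt_snd (h : IsLeftPoincareImage T D a y₀ y₁ τ Ψ) (t : ℝ) :
    HasDerivAt (fun t => (Ψ t).2) (D * (Ψ t).1 - a) t :=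
  (hasFDerivAt_snd (𝕜 := ℝ) (p := Ψ t)).comp_hasDerivAt t (h.orbit t)

theorem hasDerivAt_velocity_fst (h : IsLeftPoincareImage T D a y₀ y₁ τ Ψ) (t : ℝ) :
    HasDerivAt (fun t => T * (Ψ t).1 - (Ψ t).2)
      (T * (T * (Ψ t).1 - (Ψ t).2) - (D * (Ψ t).1 - a)) t :=
  ((h.hasDerivAt_fst t).const_mul T).sub (h.hasDerivAt_snd t)

theorem hasDerivAt_velocity_snd (h : IsLeftPoincareImage T D a y₀ y₁ τ Ψ) (t : ℝ) :
    HasDerivAt (fun t => D * (Ψ t).1 - a) (D * (T * (Ψ t).1 - (Ψ t).2)) t :=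
  ((h.hasDerivAt_fst t).const_mul D).sub_const a

theorem continuous (h : IsLeftPoincareImage T D a y₀ y₁ τ Ψ) : Continuous Ψ :=
  continuous_iff_continuousAt.2 fun t => (h.orbit t).continuousAt

theorem fst_zero (h : IsLeftPoincareImage T D a y₀ y₁ τ Ψ) : (Ψ 0).1 = 0 := by rw [h.start]
theorem snd_zero (h : IsLeftPoincareImage T D a y₀ y₁ τ Ψ) : (Ψ 0).2 = y₀ := by rw [h.start]
theorem fst_return (h : IsLeftPoincareImage T D a y₀ y₁ τ Ψ) : (Ψ τ).1 = 0 := by rw [h.return_eq]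
theorem snd_return (h : IsLeftPoincareImage T D a y₀ y₁ τ Ψ) : (Ψ τ).2 = y₁ := by
  rw [h.return_eq]

/-- At the return `x` reaches zero from below, so `-y₁`, its derivative there, is nonnegative. -/
theorem end_nonpos (h : IsLeftPoincareImage T D a y₀ y₁ τ Ψ) : y₁ ≤ 0 := by
  have := deriv_nonneg_of_neg_left h.time_pos (h.hasDerivAt_fst τ) h.fst_return h.left
  rw [h.fst_return, h.snd_return] at this
  linarith

theorem end_le_start (h : IsLeftPoincareImage T D a y₀ y₁ τ Ψ) : y₁ ≤ y₀ :=
  h.end_nonpos.trans h.start_nonneg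

theorem fst_nonpos (h : IsLeftPoincareImage T D a y₀ y₁ τ Ψ) {t : ℝ} (ht : t ∈ Icc 0 τ) :
    (Ψ t).1 ≤ 0 := by
  rcases ht.1.eq_or_lt with rfl | h0
  · exact h.fst_zero.le
  rcases ht.2.eq_or_lt with rfl | h1
  · exact h.fst_return.le
  · exact (h.left t ⟨h0, h1⟩).le

theorem gam_eq (h : IsLeftPoincareImage T D a y₀ y₁ τ Ψ) :
    Gam y₀ y₁ τ Ψ = (fun y : ℝ => ((0 : ℝ), y)) '' Icc y₁ y₀ ∪ Ψ '' Icc 0 τ := by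
  refine Subset.antisymm (union_subset_union_left _ (image_mono Ioo_subset_Icc_self))
    (union_subset ?_ subset_union_right)
  rintro _ ⟨y, hy, rfl⟩
  rcases hy.1.eq_or_lt with rfl | h1
  · exact Or.inr ⟨τ, ⟨h.time_pos.le, le_rfl⟩, h.return_eq⟩
  rcases hy.2.eq_or_lt with rfl | h2
  · exact Or.inr ⟨0, ⟨le_rfl, h.time_pos.le⟩, h.start⟩
  · exact Or.inl ⟨y, ⟨h1, h2⟩, rfl⟩

theorem mem_gam_iff (h : IsLeftPoincareImage T D a y₀ y₁ τ Ψ) {p : ℝ × ℝ} :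
    p ∈ Gam y₀ y₁ τ Ψ ↔ (p.1 = 0 ∧ p.2 ∈ Icc y₁ y₀) ∨ ∃ t ∈ Icc 0 τ, Ψ t = p := by
  rw [h.gam_eq, mem_union, mem_image, mem_image]
  refine or_congr ⟨?_, ?_⟩ Iff.rfl
  · rintro ⟨y, hy, rfl⟩; exact ⟨rfl, hy⟩
  · rintro ⟨h1, h2⟩; exact ⟨p.2, h2, Prod.ext h1.symm rfl⟩

theorem isCompact_gam (h : IsLeftPoincareImage T D a y₀ y₁ τ Ψ) :
    IsCompact (Gam y₀ y₁ τ Ψ) := by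
  rw [h.gam_eq]
  exact (isCompact_Icc.image (by fun_prop)).union (isCompact_Icc.image h.continuous)

theorem zero_mem_gam (h : IsLeftPoincareImage T D a y₀ y₁ τ Ψ) :
    ((0 : ℝ), (0 : ℝ)) ∈ Gam y₀ y₁ τ Ψ :=
  h.mem_gam_iff.2 (Or.inl ⟨rfl, h.end_nonpos, h.start_nonneg⟩)

theorem V_eq_mul_exp (h : IsLeftPoincareImage T D a y₀ y₁ τ Ψ) (t : ℝ) :
    V T D a (Ψ t).1 (Ψ t).2 = V T D a 0 y₀ * exp (T * t) := by
  have hV := eq_mul_exp (k := T) (f := fun t => (D * (Ψ t).1 - a) ^ 2 -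
      T * (T * (Ψ t).1 - (Ψ t).2) * (D * (Ψ t).1 - a) + D * (T * (Ψ t).1 - (Ψ t).2) ^ 2)
    (fun s => by
      have h1 := h.hasDerivAt_velocity_snd s
      have h2 := h.hasDerivAt_velocity_fst s
      exact (((h1.pow 2).sub ((h2.const_mul T).mul h1)).add ((h2.pow 2).const_mul D)).congr_deriv
        (by push_cast; ring)) t
  simp only [h.fst_zero, h.snd_zero] at hV
  simp only [V]
  linear_combination hV

/-- The form `w - r u` is a left eigenvector of the linear system satisfied by the velocity. -/
theorem eigen_eq_mul_exp (h : IsLeftPoincareImage T D a y₀ y₁ τ Ψ) {r : ℝ}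
    (hr : r ^ 2 - T * r + D = 0) (t : ℝ) :
    D * (Ψ t).1 - a - r * (T * (Ψ t).1 - (Ψ t).2) = (r * y₀ - a) * exp (r * t) := by
  have hV := eq_mul_exp (k := r) (f := fun t => D * (Ψ t).1 - a - r * (T * (Ψ t).1 - (Ψ t).2))
    (fun s => by
      have h1 := h.hasDerivAt_velocity_snd s
      have h2 := h.hasDerivAt_velocity_fst s
      exact (h1.sub (h2.const_mul r)).congr_deriv
        (by linear_combination (T * (Ψ s).1 - (Ψ s).2) * hr)) t
  simp only [h.fst_zero, h.snd_zero] at hV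
  linear_combination hV

/-- On the orbit the velocity stays on one side of each real eigendirection. -/
theorem eigen_neg (h : IsLeftPoincareImage T D a y₀ y₁ τ Ψ) (ha : a ≠ 0) {r : ℝ}
    (hr : r ^ 2 - T * r + D = 0) : r * y₀ - a < 0 := by
  by_contra! hC
  -- If the form were nonnegative, `y - r x` would be nondecreasing, forcing `y₀ ≤ y₁`, so both are
  -- zero; then `a ≠ 0` makes the growth strict.
  have hd : ∀ t, HasDerivAt (fun t => (Ψ t).2 - r * (Ψ t).1) ((r * y₀ - a) * exp (r * t)) t :=
    fun t => ((h.hasDerivAt_snd t).sub ((h.hasDerivAt_fst t).const_mul r)).congr_deriv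
      (by rw [← h.eigen_eq_mul_exp hr t])
  have hmono : Monotone fun t => (Ψ t).2 - r * (Ψ t).1 :=
    monotone_of_hasDerivAt_nonneg hd fun t => mul_nonneg hC (exp_pos _).le
  have hle := hmono h.time_pos.le
  simp only [h.fst_zero, h.snd_zero, h.fst_return, h.snd_return] at hle
  have h0 : y₀ = 0 := by linarith [h.end_nonpos, h.start_nonneg]
  have h1 : y₁ = 0 := by linarith [h.end_nonpos, h.start_nonneg]
  have hpos : 0 < r * y₀ - a := lt_of_le_of_ne hC (by rw [h0]; simpa using ha)
  have hlt := strictMono_of_hasDerivAt_pos hd (fun t => mul_pos hpos (exp_pos _)) h.time_pos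
  simp only [h.fst_zero, h.snd_zero, h.fst_return, h.snd_return, h0, h1] at hlt
  linarith

theorem exists_eigenvalues (hdisc : 4 * D - T ^ 2 ≤ 0) :
    ∃ r s : ℝ, r + s = T ∧ r * s = D ∧ r ^ 2 - T * r + D = 0 ∧ s ^ 2 - T * s + D = 0 := by
  have hsq := Real.sq_sqrt (show 0 ≤ T ^ 2 - 4 * D by linarith)
  refine ⟨(T + √(T ^ 2 - 4 * D)) / 2, (T - √(T ^ 2 - 4 * D)) / 2, by ring, ?_, ?_, ?_⟩ <;>
    nlinarith

/-- A real eigenvalue would give `y₁` the sign of `y₀`, hence `y₀ = 0`; the other eigenvalue then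
gives `x' = s x`, so `x` vanishes identically. -/
theorem disc_pos_of_zero (h : IsLeftPoincareImage T D 0 y₀ y₁ τ Ψ) (hD : D ≠ 0) :
    0 < 4 * D - T ^ 2 := by
  by_contra! hdisc
  obtain ⟨r, s, hT, hrs, hr, -⟩ := exists_eigenvalues hdisc
  have hr0 : r ≠ 0 := by rintro rfl; exact hD (by linarith)
  have he := h.eigen_eq_mul_exp hr
  have hy0 : y₀ = 0 := by
    have h1 := he τ
    rw [h.fst_return, h.snd_return] at h1
    have h2 : y₁ = y₀ * exp (r * τ) := mul_left_cancel₀ hr0 (by linear_combination h1)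
    have h3 := mul_nonneg h.start_nonneg (exp_pos (r * τ)).le
    have h4 : y₀ * exp (r * τ) = 0 := le_antisymm (h2 ▸ h.end_nonpos) h3
    exact (mul_eq_zero.1 h4).resolve_right (exp_pos _).ne'
  have hx := eq_mul_exp (k := s) (f := fun t => (Ψ t).1) fun t =>
    (h.hasDerivAt_fst t).congr_deriv (by
      have h1 := he t
      rw [hy0] at h1
      apply mul_left_cancel₀ hr0
      linear_combination (-1) * h1 - (Ψ t).1 * hrs)
  have hneg := h.left (τ / 2) ⟨by linarith [h.time_pos], by linarith [h.time_pos]⟩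
  rw [hx, h.fst_zero, zero_mul] at hneg
  exact lt_irrefl _ hneg

/-- With real eigenvalues `r, s`, both forms are negative. Where `w = 0` their product is `D u²`, so
`D > 0` and `a < 0`. Then `r y₀` and `r y₁` both lie below `a`, against `y₁ ≤ 0 ≤ y₀`. -/
theorem disc_pos_of_crossing (h : IsLeftPoincareImage T D a y₀ y₁ τ Ψ) (ha : a ≠ 0) {t : ℝ}
    (ht : t ∈ Icc 0 τ) (hcross : D * (Ψ t).1 = a) : 0 < 4 * D - T ^ 2 := by
  by_contra! hdisc
  obtain ⟨r, s, hT, hrs, hr, hs⟩ := exists_eigenvalues hdisc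
  have hrn := h.eigen_neg ha hr
  have hsn := h.eigen_neg ha hs
  have hr1 := h.eigen_eq_mul_exp hr t
  have hs1 := h.eigen_eq_mul_exp hs t
  rw [hcross, sub_self, zero_sub] at hr1 hs1
  have hr2 := mul_neg_of_neg_of_pos hrn (exp_pos (r * t))
  have hs2 := mul_neg_of_neg_of_pos hsn (exp_pos (s * t))
  rw [← hr1] at hr2
  rw [← hs1] at hs2
  have hDpos : 0 < D := by
    have := mul_pos_of_neg_of_neg hr2 hs2
    rw [← hrs]
    by_contra! hc
    nlinarith [mul_nonneg (neg_nonneg.2 hc) (sq_nonneg (T * (Ψ t).1 - (Ψ t).2))]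
  have ha' : a < 0 := lt_of_le_of_ne
    (by rw [← hcross]; exact mul_nonpos_of_nonneg_of_nonpos hDpos.le (h.fst_nonpos ht)) ha
  have hr3 := h.eigen_eq_mul_exp hr τ
  rw [h.fst_return, h.snd_return] at hr3
  have hr4 := mul_neg_of_neg_of_pos hrn (exp_pos (r * τ))
  have hp : 0 < (r * y₀) * (r * y₁) := mul_pos_of_neg_of_neg (by linarith) (by linarith)
  nlinarith [mul_nonneg (sq_nonneg r) (mul_nonneg h.start_nonneg (neg_nonneg.2 h.end_nonpos))]

/-! ### Orbits along which `y` is monotone -/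

theorem hasPV_of_not_crossing (h : IsLeftPoincareImage T D a y₀ y₁ τ Ψ) (ha : a ≠ 0)
    (hcross : ∀ t ∈ Icc 0 τ, D * (Ψ t).1 - a ≠ 0) :
    HasPV (fun y => -y / V T D a 0 y) y₁ y₀ 0 := by
  -- `(0, η)` is the point of the section where the field is parallel to the current velocity, so
  -- `η' = -V(0, η)/a` is a Riccati equation.
  set η : ℝ → ℝ := fun t => a * (T * (Ψ t).1 - (Ψ t).2) / (D * (Ψ t).1 - a) with hη
  have hη0 : η 0 = y₀ := by simp only [hη, h.fst_zero, h.snd_zero]; field_simp; simp [ha]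
  have hη1 : η τ = y₁ := by simp only [hη, h.fst_return, h.snd_return]; field_simp; simp [ha]
  have hτ := h.time_pos.le
  have hVη : ∀ t ∈ Icc 0 τ, V T D a 0 (η t) =
      a ^ 2 * (V T D a 0 y₀ * exp (T * t)) / (D * (Ψ t).1 - a) ^ 2 := by
    intro t ht
    have := hcross t ht
    rw [← h.V_eq_mul_exp t]
    simp only [V, hη]
    field_simp
    ring
  have hηd : ∀ t ∈ Icc 0 τ, HasDerivAt η (-V T D a 0 (η t) / a) t := by
    intro t ht
    have hne := hcross t ht
    refine (((h.hasDerivAt_velocity_fst t).const_mul a).div (h.hasDerivAt_velocity_snd t) hne).congr_deriv ?_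
    rw [hVη t ht, ← h.V_eq_mul_exp t]
    simp only [V]
    field_simp
    ring
  have hηc : ContinuousOn η (Icc 0 τ) := fun t ht => (hηd t ht).continuousAt.continuousWithinAt
  -- Otherwise `η` is constant, so `y₀ = y₁ = 0`, but `V(0, 0) = a²`.
  have hV0 : V T D a 0 y₀ ≠ 0 := by
    intro hV
    have hconst := constant_of_has_deriv_right_zero hηc (fun t ht =>
      ((hηd t (Ico_subset_Icc_self ht)).congr_deriv (by
        rw [hVη t (Ico_subset_Icc_self ht), hV]; simp)).hasDerivWithinAt) τ ⟨hτ, le_rfl⟩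
    rw [hη0, hη1] at hconst
    have hy : y₀ = 0 := by linarith [h.end_nonpos, h.start_nonneg]
    simp [V, hy, ha] at hV
  have hVη0 : ∀ t ∈ Icc 0 τ, V T D a 0 (η t) ≠ 0 := by
    intro t ht
    rw [hVη t ht]
    exact div_ne_zero (mul_ne_zero (pow_ne_zero _ ha) (mul_ne_zero hV0 (exp_pos _).ne'))
      (pow_ne_zero _ (hcross t ht))
  have hcont : ContinuousOn (fun y => -y / V T D a 0 y) (η '' Icc 0 τ) := by
    refine ContinuousOn.div (by fun_prop) (by unfold V; fun_prop) ?_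
    rintro _ ⟨t, ht, rfl⟩
    exact hVη0 t ht
  have himg : Icc y₁ y₀ ⊆ η '' Icc 0 τ := by
    have := intermediate_value_Icc' hτ hηc
    rwa [hη0, hη1] at this
  have hxd : ∀ t ∈ Icc 0 τ, HasDerivAt (fun t => (Ψ t).1) (T * (Ψ t).1 - (Ψ t).2) t :=
    fun t _ => h.hasDerivAt_fst t
  have hΨ := h.continuous
  have hint : ∫ y in y₁..y₀, -y / V T D a 0 y = 0 := by
    have e1 : ∫ t in (0 : ℝ)..τ, ((fun y => -y / V T D a 0 y) ∘ η) t * (-V T D a 0 (η t) / a) =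
        ∫ y in η 0..η τ, -y / V T D a 0 y := by
      refine intervalIntegral.integral_comp_mul_deriv' ?_ ?_ ?_
      · rw [uIcc_of_le hτ]; exact hηd
      · rw [uIcc_of_le hτ]
        have : ContinuousOn (fun y => V T D a 0 y) univ := by unfold V; fun_prop
        exact ((this.comp hηc (mapsTo_univ _ _)).neg).div_const a
      · rw [uIcc_of_le hτ]; exact hcont
    have e2 : ∫ t in (0 : ℝ)..τ, ((fun x => (D * x - a)⁻¹) ∘ fun t => (Ψ t).1) t *
          (T * (Ψ t).1 - (Ψ t).2) =
        ∫ x in (Ψ 0).1..(Ψ τ).1, (D * x - a)⁻¹ := by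
      refine intervalIntegral.integral_comp_mul_deriv' ?_ ?_ ?_
      · rw [uIcc_of_le hτ]; exact hxd
      · fun_prop
      · rw [uIcc_of_le hτ]
        refine ContinuousOn.inv₀ (by fun_prop) ?_
        rintro _ ⟨t, ht, rfl⟩
        exact hcross t ht
    rw [h.fst_zero, h.fst_return, intervalIntegral.integral_same] at e2
    rw [hη0, hη1] at e1
    rw [intervalIntegral.integral_symm, ← e1, neg_eq_zero]
    refine Eq.trans ?_ e2
    refine intervalIntegral.integral_congr fun t ht => ?_
    rw [uIcc_of_le hτ] at ht
    have hne := hVη0 t ht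
    have hne' := hcross t ht
    simp only [Function.comp]
    rw [show -η t / V T D a 0 (η t) * (-V T D a 0 (η t) / a) = η t / a by field_simp]
    simp only [hη]
    field_simp
  have := hasPV_of_continuousOn h.end_nonpos h.start_nonneg (hcont.mono himg)
  rwa [hint] at this

/-- The vertical line through the equilibrium misses `Γ`, so its component is unbounded. -/
theorem equilibrium_notMem_of_not_crossing (h : IsLeftPoincareImage T D a y₀ y₁ τ Ψ)
    (ha : a ≠ 0) (hcross : ∀ t ∈ Icc 0 τ, D * (Ψ t).1 - a ≠ 0) {p : ℝ × ℝ}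
    (hp : IsEquilibrium T D a p) :
    p ∉ Gam y₀ y₁ τ Ψ ∪ jordanInt (Gam y₀ y₁ τ Ψ) := by
  obtain ⟨-, hp⟩ := isEquilibrium_iff.1 hp
  have hline : ({p.1} ×ˢ univ : Set (ℝ × ℝ)) ⊆ (Gam y₀ y₁ τ Ψ)ᶜ := by
    rintro ⟨u, v⟩ ⟨hu, -⟩ hmem
    rw [mem_singleton_iff] at hu
    simp only at hu
    subst hu
    rcases h.mem_gam_iff.1 hmem with ⟨h0, -⟩ | ⟨t, ht, he⟩
    · simp only at h0
      exact ha (by rw [← hp, h0, mul_zero])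
    · exact hcross t ht (by rw [he]; simp [hp])
  have hpl : p ∈ ({p.1} ×ˢ univ : Set (ℝ × ℝ)) := ⟨rfl, trivial⟩
  rintro (hG | ⟨-, hb⟩)
  · exact hline hpl hG
  · have hsub := (isPreconnected_singleton.prod isPreconnected_univ).subset_connectedComponentIn
      hpl hline
    have hb' := (hb.subset hsub).image_snd
    rw [snd_image_prod (singleton_nonempty _)] at hb'
    exact NormedSpace.unbounded_univ ℝ ℝ hb'

end IsLeftPoincareImage

/-! ### Angles and spiral coordinates around a focus -/

theorem exists_eq_arctan_tan_add {φ : ℝ} (hφ : 0 < cos φ) :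
    ∃ k : ℤ, φ = arctan (tan φ) + k * (2 * π) := by
  set k := round (φ / (2 * π))
  have hpi := two_pi_pos
  have hcos : cos (φ - k * (2 * π)) = cos φ := cos_sub_int_mul_two_pi φ k
  have hsin : sin (φ - k * (2 * π)) = sin φ := sin_sub_int_mul_two_pi φ k
  have htan : tan (φ - k * (2 * π)) = tan φ := by rw [tan_eq_sin_div_cos, hcos, hsin,
    tan_eq_sin_div_cos]
  have habs : |φ - k * (2 * π)| ≤ π := by
    have h := abs_sub_round (φ / (2 * π))
    have e : φ - k * (2 * π) = (φ / (2 * π) - k) * (2 * π) := by field_simp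
    rw [e, abs_mul, abs_of_pos hpi]
    linarith [mul_le_mul_of_nonneg_right h hpi.le]
  have hlt : |φ - k * (2 * π)| < π / 2 := by
    by_contra! hge
    have := cos_nonpos_of_pi_div_two_le_of_le hge (by linarith [pi_pos])
    rw [cos_abs, hcos] at this
    linarith
  obtain ⟨h1, h2⟩ := abs_lt.1 hlt
  refine ⟨k, ?_⟩
  rw [← htan, arctan_tan h1 h2]
  ring

theorem div_cos_mul_sin (c φ : ℝ) : c / cos φ * sin φ = c * tan φ := by
  rw [tan_eq_sin_div_cos]; ring

theorem tan_sub_two_mul_pi (φ : ℝ) : tan (φ - 2 * π) = tan φ := by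
  rw [tan_eq_sin_div_cos, sin_sub_two_pi, cos_sub_two_pi, tan_eq_sin_div_cos]

namespace IsLeftPoincareImage

variable {T D a y₀ y₁ τ ω : ℝ} {Ψ : ℝ → ℝ × ℝ}

theorem orbit_eq_spiral (h : IsLeftPoincareImage T D a y₀ y₁ τ Ψ) (hD : D ≠ 0)
    (hω : ω ^ 2 = D - T ^ 2 / 4) {ρ θ : ℝ} (h1 : -(ω * a / D) = ρ * cos θ)
    (h2 : y₀ - a * T / (2 * D) = ρ * sin θ) (t : ℝ) :
    ω * ((Ψ t).1 - a / D) = ρ * exp (T / 2 * t) * cos (θ + ω * t) ∧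
    (Ψ t).2 - a * T / D - T / 2 * ((Ψ t).1 - a / D) =
      ρ * exp (T / 2 * t) * sin (θ + ω * t) := by
  refine spiral_eq (P := fun t => ω * ((Ψ t).1 - a / D))
    (Q := fun t => (Ψ t).2 - a * T / D - T / 2 * ((Ψ t).1 - a / D)) (fun s => ?_) (fun s => ?_)
    ?_ ?_ t
  · refine (((h.hasDerivAt_fst s).sub_const (a / D)).const_mul ω).congr_deriv ?_
    field_simp
    ring
  · refine (((h.hasDerivAt_snd s).sub_const (a * T / D)).sub
      (((h.hasDerivAt_fst s).sub_const (a / D)).const_mul (T / 2))).congr_deriv ?_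
    rw [show ω * (ω * ((Ψ s).1 - a / D)) = ω ^ 2 * ((Ψ s).1 - a / D) by ring, hω]
    field_simp
    ring
  · simp only [h.fst_zero]
    rw [← h1]; ring
  · simp only [h.fst_zero, h.snd_zero]
    rw [← h2]
    field_simp
    ring

/-! ### The equilibrium on the section -/

theorem flight_time_of_zero (h : IsLeftPoincareImage T D 0 y₀ y₁ τ Ψ) (hD : D ≠ 0) (hω0 : 0 < ω)
    (hω : ω ^ 2 = D - T ^ 2 / 4) :
    0 < y₀ ∧ ω * τ = π ∧ y₁ = -(y₀ * exp (T / 2 * τ)) := by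
  -- The focus is the origin and the section is `P = 0`, so `x` is a nonnegative multiple of `-sin
  -- (ω t)`.
  have hs := h.orbit_eq_spiral hD hω (ρ := y₀) (θ := π / 2) (by simp) (by simp)
  simp only [zero_div, sub_zero, zero_mul, add_comm (π / 2), cos_add_pi_div_two,
    sin_add_pi_div_two] at hs
  have hτ := h.time_pos
  have hy : 0 < y₀ := by
    refine lt_of_le_of_ne h.start_nonneg fun h0 => ?_
    have h1 := (hs (τ / 2)).1
    have h2 := h.left (τ / 2) ⟨by linarith, by linarith⟩
    rw [← h0, zero_mul, zero_mul] at h1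
    nlinarith
  have hsin : ∀ t ∈ Ioo 0 τ, 0 < sin (ω * t) := by
    intro t ht
    have h1 := (hs t).1
    have h2 := mul_neg_of_pos_of_neg hω0 (h.left t ht)
    by_contra! hc
    have h3 := mul_nonneg (mul_pos hy (exp_pos (T / 2 * t))).le (neg_nonneg.2 hc)
    linarith
  have hsinτ : sin (ω * τ) = 0 := by
    have h1 := (hs τ).1
    rw [h.fst_return, mul_zero] at h1
    have := (mul_eq_zero.1 h1.symm).resolve_left (mul_pos hy (exp_pos _)).ne'
    linarith
  have hωτ : ω * τ = π := by
    rcases lt_trichotomy (ω * τ) π with hlt | heq | hgt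
    · exact absurd hsinτ (sin_pos_of_pos_of_lt_pi (mul_pos hω0 hτ) hlt).ne'
    · exact heq
    · have := hsin (π / ω) ⟨by positivity, by rw [div_lt_iff₀ hω0]; linarith⟩
      rw [mul_div_cancel₀ _ hω0.ne', sin_pi] at this
      exact absurd this (lt_irrefl _)
  refine ⟨hy, hωτ, ?_⟩
  have h1 := (hs τ).2
  rw [hωτ, h.fst_return, h.snd_return, cos_pi] at h1
  linarith

theorem hasPV_of_zero (h : IsLeftPoincareImage T D 0 y₀ y₁ τ Ψ) (hD : D ≠ 0) (hω0 : 0 < ω)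
    (hω : ω ^ 2 = D - T ^ 2 / 4) :
    HasPV (fun y => -y / V T D 0 0 y) y₁ y₀ (π * T / (D * (2 * ω))) := by
  obtain ⟨hy, hτ, hy1⟩ := h.flight_time_of_zero hD hω0 hω
  have hE := exp_pos (T / 2 * τ)
  have h1 : y₁ < 0 := by rw [hy1]; exact neg_lt_zero.2 (mul_pos hy hE)
  have := hasPV_inv (D := D) h1 hy
  rw [hy1, neg_neg, log_mul hy.ne' hE.ne', log_exp, ← hy1] at this
  convert this using 1
  · ext y; simp [V]
  · rw [← hτ]; field_simp; ring

/-! ### The equilibrium to the left of the section -/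

/-- The section is the line `P = c > 0`, so the endpoint angles are arctangents and the turn is
known mod `2π`; it remains to find the integer `k`. -/
theorem flight_time_of_crossing (h : IsLeftPoincareImage T D a y₀ y₁ τ Ψ) (hD : 0 < D)
    (ha : a < 0) (hω0 : 0 < ω) (hω : ω ^ 2 = D - T ^ 2 / 4) {c : ℝ} (hc : c = -(ω * a / D))
    {t₀ : ℝ} (ht₀ : t₀ ∈ Icc 0 τ) (hcross : D * (Ψ t₀).1 = a) :
    ω * τ = arctan ((y₁ - a * T / (2 * D)) / c) - arctan ((y₀ - a * T / (2 * D)) / c) + 2 * π := by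
  have hcp : 0 < c := by
    rw [hc, neg_pos]; exact div_neg_of_neg_of_pos (mul_neg_of_pos_of_neg hω0 ha) hD
  set θ₀ := arctan ((y₀ - a * T / (2 * D)) / c) with hθ₀
  set θ₁ := arctan ((y₁ - a * T / (2 * D)) / c) with hθ₁
  have hcosθ : 0 < cos θ₀ := cos_arctan_pos _
  have hs := h.orbit_eq_spiral hD.ne' hω (ρ := c / cos θ₀) (θ := θ₀)
    (by rw [← hc]; field_simp) (by
      rw [div_cos_mul_sin, hθ₀, tan_arctan, mul_div_cancel₀ _ hcp.ne'])
  have hρ : 0 < c / cos θ₀ := by positivity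
  have hτ := h.time_pos
  have hPτ := (hs τ).1
  have hQτ := (hs τ).2
  rw [h.fst_return] at hPτ hQτ
  rw [h.snd_return] at hQτ
  have hPτ' : c = c / cos θ₀ * exp (T / 2 * τ) * cos (θ₀ + ω * τ) := by
    rw [← hPτ, hc]; ring
  have hcosφ : 0 < cos (θ₀ + ω * τ) := by
    by_contra! hn
    have := mul_nonneg (mul_pos hρ (exp_pos (T / 2 * τ))).le (neg_nonneg.2 hn)
    linarith
  have htan : tan (θ₀ + ω * τ) = (y₁ - a * T / (2 * D)) / c := by
    have h1 : y₁ - a * T / (2 * D) = c / cos θ₀ * exp (T / 2 * τ) * sin (θ₀ + ω * τ) := by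
      rw [← hQτ]; field_simp; ring
    rw [h1, tan_eq_sin_div_cos, div_eq_div_iff hcosφ.ne' hcp.ne']
    linear_combination sin (θ₀ + ω * τ) * hPτ'
  obtain ⟨k, hk⟩ := exists_eq_arctan_tan_add hcosφ
  rw [htan, ← hθ₁] at hk
  have b0 := arctan_lt_pi_div_two ((y₀ - a * T / (2 * D)) / c)
  have b0' := neg_pi_div_two_lt_arctan ((y₀ - a * T / (2 * D)) / c)
  have b1 := arctan_lt_pi_div_two ((y₁ - a * T / (2 * D)) / c)
  have b1' := neg_pi_div_two_lt_arctan ((y₁ - a * T / (2 * D)) / c)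
  rw [← hθ₀] at b0 b0'
  rw [← hθ₁] at b1 b1'
  have hpi := pi_pos
  -- For `k ≤ 0` the angle stays in `(-π/2, π/2)`, so `P > 0`, but `P = 0` at the crossing.
  have hk1 : 1 ≤ k := by
    by_contra! hk0
    have hk0' : (k : ℝ) ≤ 0 := by exact_mod_cast Int.le_of_lt_add_one (by simpa using hk0)
    have hφ : θ₀ + ω * τ < π / 2 := by nlinarith
    have hpos : 0 < cos (θ₀ + ω * t₀) := cos_pos_of_mem_Ioo
      ⟨by linarith [mul_nonneg hω0.le ht₀.1], by linarith [mul_le_mul_of_nonneg_left ht₀.2 hω0.le]⟩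
    have hP := (hs t₀).1
    have hx : (Ψ t₀).1 - a / D = 0 := by rw [← hcross]; field_simp; ring
    rw [hx, mul_zero] at hP
    exact absurd hP.symm (mul_pos (mul_pos hρ (exp_pos _)) hpos).ne'
  -- For `k ≥ 2`, one full turn after the start and one before the end `P` equals `c` times mutually
  -- inverse factors, both less than one since `x < 0` there.
  have hk2 : k ≤ 1 := by
    by_contra! hk0
    have hk0' : (2 : ℝ) ≤ k := by exact_mod_cast hk0
    have hφ : 2 * π < ω * τ := by nlinarith
    set s := 2 * π / ω with hsdef
    have hs0 : 0 < s := by positivity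
    have hωs : ω * s = 2 * π := mul_div_cancel₀ _ hω0.ne'
    have hsτ : s < τ := by rw [hsdef, div_lt_iff₀ hω0]; linarith
    have key : ∀ t ∈ Ioo 0 τ, c / cos θ₀ * exp (T / 2 * t) * cos (θ₀ + ω * t) < c := by
      intro t ht
      rw [← (hs t).1, hc]
      have := mul_neg_of_pos_of_neg hω0 (h.left t ht)
      have e : ω * ((Ψ t).1 - a / D) = ω * (Ψ t).1 + -(ω * a / D) := by ring
      linarith
    have k1 := key s ⟨hs0, hsτ⟩
    have k2 := key (τ - s) ⟨by linarith, by linarith⟩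
    rw [hωs, cos_add_two_pi, mul_right_comm, div_mul_cancel₀ _ hcosθ.ne'] at k1
    have e2 : c / cos θ₀ * exp (T / 2 * (τ - s)) * cos (θ₀ + ω * (τ - s)) =
        c * exp (-(T / 2 * s)) := by
      rw [mul_sub ω, hωs, ← add_sub_assoc, cos_sub_two_pi, mul_sub, sub_eq_add_neg, exp_add]
      conv_rhs => rw [hPτ']
      ring
    rw [e2] at k2
    have l1 : exp (T / 2 * s) < 1 := by nlinarith
    have l2 : exp (-(T / 2 * s)) < 1 := by nlinarith
    rw [exp_lt_one_iff] at l1 l2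
    linarith
  have hk3 : k = 1 := le_antisymm hk2 hk1
  rw [hk3] at hk
  push_cast at hk
  linarith

theorem hasPV_of_flight_time (h : IsLeftPoincareImage T D a y₀ y₁ τ Ψ) (hD : 0 < D)
    (ha : a < 0) (hω0 : 0 < ω) (hω : ω ^ 2 = D - T ^ 2 / 4) {c : ℝ} (hc : c = -(ω * a / D))
    (hτ : ω * τ = arctan ((y₁ - a * T / (2 * D)) / c) -
      arctan ((y₀ - a * T / (2 * D)) / c) + 2 * π) :
    HasPV (fun y => -y / V T D a 0 y) y₁ y₀ (2 * π * T / (D * (2 * ω))) := by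
  have hcp : 0 < c := by
    rw [hc, neg_pos]; exact div_neg_of_neg_of_pos (mul_neg_of_pos_of_neg hω0 ha) hD
  have hV : ∀ y, V T D a 0 y = D * (c ^ 2 + (y - a * T / (2 * D)) ^ 2) := by
    intro y
    have : c ^ 2 = (D - T ^ 2 / 4) * a ^ 2 / D ^ 2 := by rw [hc, ← hω]; ring
    rw [this]
    simp only [V]
    field_simp
    ring
  have hVpos : ∀ y, 0 < V T D a 0 y := fun y => by rw [hV]; positivity
  have hVc : Continuous fun y => V T D a 0 y := by unfold V; fun_prop
  have hcont : Continuous fun y => -y / V T D a 0 y :=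
    continuous_neg.div hVc fun y => (hVpos y).ne'
  have hVd : ∀ y, HasDerivAt (fun y => V T D a 0 y) (2 * D * (y - a * T / (2 * D))) y := by
    intro y
    simp only [hV]
    refine (((((hasDerivAt_id y).sub_const (a * T / (2 * D))).pow 2).const_add
      (c ^ 2)).const_mul D).congr_deriv ?_
    simp only [id]
    push_cast
    ring
  have hF : ∀ y, HasDerivAt (fun y => -(1 / (2 * D)) * log (V T D a 0 y) +
      T / (2 * D * ω) * arctan ((y - a * T / (2 * D)) / c)) (-y / V T D a 0 y) y := by
    intro y
    refine ((((hVd y).log (hVpos y).ne').const_mul (-(1 / (2 * D)))).add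
      (((((hasDerivAt_id y).sub_const (a * T / (2 * D))).div_const c).arctan).const_mul
        (T / (2 * D * ω)))).congr_deriv ?_
    have hq : 0 < c ^ 2 + (y - a * T / (2 * D)) ^ 2 := by positivity
    simp only [id]
    rw [hV]
    have e1 : 1 / (1 + ((y - a * T / (2 * D)) / c) ^ 2) * (1 / c) =
        c / (c ^ 2 + (y - a * T / (2 * D)) ^ 2) := by
      rw [div_pow]; field_simp
    rw [e1]
    generalize c ^ 2 + (y - a * T / (2 * D)) ^ 2 = q at hq
    rw [hc]
    field_simp
    ring
  have hint : ∫ y in y₁..y₀, -y / V T D a 0 y = 2 * π * T / (D * (2 * ω)) := by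
    rw [intervalIntegral.integral_eq_sub_of_hasDerivAt (fun y _ => hF y)
      (hcont.intervalIntegrable _ _)]
    have hVτ := h.V_eq_mul_exp τ
    rw [h.fst_return, h.snd_return] at hVτ
    rw [hVτ, log_mul (hVpos _).ne' (exp_pos _).ne', log_exp]
    rw [show arctan ((y₁ - a * T / (2 * D)) / c) =
      ω * τ + arctan ((y₀ - a * T / (2 * D)) / c) - 2 * π by linarith]
    field_simp
    ring
  have := hasPV_of_continuousOn h.end_nonpos h.start_nonneg hcont.continuousOn
  rwa [hint] at this

theorem mem_jordanInt_of_flight_time (h : IsLeftPoincareImage T D a y₀ y₁ τ Ψ) (hD : 0 < D)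
    (ha : a < 0) (hω0 : 0 < ω) (hω : ω ^ 2 = D - T ^ 2 / 4) {c : ℝ} (hc : c = -(ω * a / D))
    (hτ : ω * τ = arctan ((y₁ - a * T / (2 * D)) / c) -
      arctan ((y₀ - a * T / (2 * D)) / c) + 2 * π) :
    (a / D, a * T / D) ∈ jordanInt (Gam y₀ y₁ τ Ψ) := by
  have hcp : 0 < c := by
    rw [hc, neg_pos]; exact div_neg_of_neg_of_pos (mul_neg_of_pos_of_neg hω0 ha) hD
  set θ₀ := arctan ((y₀ - a * T / (2 * D)) / c) with hθ₀
  set θ₁ := arctan ((y₁ - a * T / (2 * D)) / c) with hθ₁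
  have hpi := pi_pos
  have hθ : θ₁ ≤ θ₀ := arctan_strictMono.monotone (by gcongr; exact h.end_le_start)
  have b0 : θ₀ < π / 2 := arctan_lt_pi_div_two _
  have b1 : -(π / 2) < θ₁ := neg_pi_div_two_lt_arctan _
  have hcosθ₀ : 0 < cos θ₀ := cos_arctan_pos _
  set ρ := c / cos θ₀ with hρdef
  have hρ : 0 < ρ := by positivity
  have hs := h.orbit_eq_spiral hD.ne' hω (ρ := ρ) (θ := θ₀)
    (by rw [← hc, hρdef, div_mul_cancel₀ _ hcosθ₀.ne']) (by
      rw [hρdef, div_cos_mul_sin, hθ₀, tan_arctan, mul_div_cancel₀ _ hcp.ne'])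
  have hcosφ : ∀ φ ∈ Icc (θ₁ + 2 * π) (θ₀ + 2 * π), 0 < cos φ := by
    intro φ hφ
    rw [← cos_sub_two_pi]
    exact cos_pos_of_mem_Ioo ⟨by linarith [hφ.1], by linarith [hφ.2]⟩
  -- Radius of `Γ` about the focus: the orbit up to angle `θ₁ + 2π`, then the segment `P = c`. The
  -- pieces agree at the seam because the orbit returns to the section.
  set g : ℝ → ℝ := fun φ =>
    if φ ≤ θ₁ + 2 * π then ρ * exp (T / (2 * ω) * (φ - θ₀)) else c / cos φ with hg
  have hg1 : ∀ φ, φ ≤ θ₁ + 2 * π → g φ = ρ * exp (T / (2 * ω) * (φ - θ₀)) := fun φ hφ => if_pos hφ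
  have hexp : ∀ t, T / (2 * ω) * (ω * t) = T / 2 * t := fun t => by field_simp
  have hg2 : ∀ φ ∈ Icc (θ₁ + 2 * π) (θ₀ + 2 * π), g φ = c / cos φ := by
    intro φ hφ
    rcases hφ.1.eq_or_lt with rfl | hlt
    · have hP := (hs τ).1
      rw [h.fst_return] at hP
      rw [hg1 _ le_rfl, show θ₁ + 2 * π - θ₀ = ω * τ by linarith, hexp,
        eq_div_iff (hcosφ _ hφ).ne', show θ₁ + 2 * π = θ₀ + ω * τ by linarith, ← hP, hc]
      ring
    · exact if_neg (not_le.2 hlt)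
  have hgpos : ∀ φ ∈ Icc θ₀ (θ₀ + 2 * π), 0 < g φ := by
    intro φ hφ
    rcases le_total φ (θ₁ + 2 * π) with hle | hle
    · rw [hg1 φ hle]; positivity
    · rw [hg2 φ ⟨hle, hφ.2⟩]; exact div_pos hcp (hcosφ φ ⟨hle, hφ.2⟩)
  have hper : g θ₀ = g (θ₀ + 2 * π) := by
    rw [hg1 θ₀ (by linarith), hg2 _ ⟨by linarith, le_rfl⟩, cos_add_two_pi]
    simp [hρdef]
  have key := isBounded_connectedComponentIn_of_polar_graph (S := Gam y₀ y₁ τ Ψ)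
    (c := (a / D, a * T / D)) (m := T / 2) (α := θ₀) (g := g) hω0 h.isCompact_gam
    ⟨_, h.zero_mem_gam⟩ hgpos hper ?_
  · exact key
  rintro ⟨v₁, v₂⟩
  rw [h.mem_gam_iff]
  simp only [Prod.mk_add_mk]
  constructor
  · rintro (⟨h1, h2⟩ | ⟨t, ht, hv⟩)
    · set Q := v₂ - T / 2 * v₁ with hQ
      have hv1 : v₁ = -(a / D) := by linarith
      have hQ' : a * T / D + v₂ = Q + a * T / (2 * D) := by
        rw [hQ, hv1]; field_simp; ring
      rw [hQ'] at h2
      have hm1 : θ₁ ≤ arctan (Q / c) :=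
        arctan_strictMono.monotone (by gcongr; linarith [h2.1])
      have hm2 : arctan (Q / c) ≤ θ₀ :=
        arctan_strictMono.monotone (by gcongr; linarith [h2.2])
      have hmem : arctan (Q / c) + 2 * π ∈ Icc (θ₁ + 2 * π) (θ₀ + 2 * π) :=
        ⟨by linarith, by linarith⟩
      have hcp' := hcosφ _ hmem
      refine ⟨arctan (Q / c) + 2 * π, ⟨by linarith, hmem.2⟩, ?_, ?_⟩
      · rw [hg2 _ hmem, div_mul_cancel₀ _ hcp'.ne', hv1, hc]; ring
      · rw [hg2 _ hmem, div_cos_mul_sin, ← tan_sub_two_mul_pi, add_sub_cancel_right,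
          tan_arctan, mul_div_cancel₀ _ hcp.ne']
    · have hle : ω * t ≤ ω * τ := mul_le_mul_of_nonneg_left ht.2 hω0.le
      have hP := hs t
      rw [hv] at hP
      simp only [add_sub_cancel_left] at hP
      refine ⟨θ₀ + ω * t, ⟨by linarith [mul_nonneg hω0.le ht.1], by linarith⟩, ?_⟩
      rw [hg1 _ (by linarith), add_sub_cancel_left, hexp]
      exact hP
  · rintro ⟨φ, hφ, hP, hQ⟩
    rcases le_total φ (θ₁ + 2 * π) with hle | hle
    · right
      have ht : ω * ((φ - θ₀) / ω) = φ - θ₀ := mul_div_cancel₀ _ hω0.ne'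
      have hS := hs ((φ - θ₀) / ω)
      rw [← hexp, ht, add_sub_cancel, ← hg1 φ hle, ← hP, ← hQ] at hS
      have e1 := mul_left_cancel₀ hω0.ne' hS.1
      rw [e1] at hS
      refine ⟨(φ - θ₀) / ω, ⟨div_nonneg (by linarith [hφ.1]) hω0.le, ?_⟩, Prod.ext ?_ ?_⟩
      · rw [div_le_iff₀ hω0]; linarith
      · simp only; linarith
      · simp only; linarith [hS.2]
    · left
      have hmem : φ ∈ Icc (θ₁ + 2 * π) (θ₀ + 2 * π) := ⟨hle, hφ.2⟩
      have hcp' := hcosφ φ hmem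
      rw [hg2 φ hmem, div_mul_cancel₀ _ hcp'.ne', hc] at hP
      have hv1 : v₁ = -(a / D) := mul_left_cancel₀ hω0.ne' (by rw [hP]; ring)
      rw [hg2 φ hmem, div_cos_mul_sin, ← tan_sub_two_mul_pi] at hQ
      have hat := arctan_tan (x := φ - 2 * π) (by linarith) (by linarith [hφ.2])
      have i1 : θ₁ ≤ arctan (tan (φ - 2 * π)) := by rw [hat]; linarith
      have i2 : arctan (tan (φ - 2 * π)) ≤ θ₀ := by rw [hat]; linarith [hφ.2]
      rw [arctan_strictMono.le_iff_le] at i1 i2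
      rw [div_le_iff₀ hcp] at i1
      rw [le_div_iff₀ hcp] at i2
      have hv2 : a * T / D + v₂ = c * tan (φ - 2 * π) + a * T / (2 * D) := by
        rw [← hQ, hv1]; field_simp; ring
      simp only [mem_Icc, hv2, hv1]
      exact ⟨by ring, by linarith, by linarith⟩

end IsLeftPoincareImage

end LienardHalfMap

open LienardHalfMap in
theorem mainTheorem1 (T D a y₀ y₁ τ : ℝ) (Ψ : ℝ → ℝ × ℝ)
    (haD : a ^ 2 + D ^ 2 ≠ 0)
    (hP : LienardHalfMap.IsLeftPoincareImage T D a y₀ y₁ τ Ψ) :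
    (∃! k : Fin 3, LienardHalfMap.Scenario T D a y₀ y₁ τ Ψ k) ∧
    ∀ k : Fin 3, LienardHalfMap.Scenario T D a y₀ y₁ τ Ψ k →
      (k ≠ 0 → 0 < 4 * D - T ^ 2) ∧
      LienardHalfMap.HasPV (fun y => -y / LienardHalfMap.V T D a 0 y) y₁ y₀
        (LienardHalfMap.d T D k) := by
  -- Exclusivity lets the estimates be proved only for the scenario that occurs.
  suffices hk : ∃ k : Fin 3, Scenario T D a y₀ y₁ τ Ψ k ∧
      (∀ j, Scenario T D a y₀ y₁ τ Ψ j → j = k) ∧ (k ≠ 0 → 0 < 4 * D - T ^ 2) ∧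
      HasPV (fun y => -y / V T D a 0 y) y₁ y₀ (d T D k) by
    obtain ⟨k, h1, h2, h3⟩ := hk
    exact ⟨⟨k, h1, h2⟩, fun j hj => by rw [h2 j hj]; exact h3⟩
  have hω : ∀ hd : 0 < 4 * D - T ^ 2, (√(4 * D - T ^ 2) / 2) ^ 2 = D - T ^ 2 / 4 := fun hd => by
    rw [div_pow, Real.sq_sqrt hd.le]; ring
  rcases eq_or_ne a 0 with rfl | ha
  · have hD : D ≠ 0 := by rintro rfl; simp at haD
    have hd := hP.disc_pos_of_zero hD
    have hω0 : 0 < √(4 * D - T ^ 2) / 2 := by have := Real.sqrt_pos.2 hd; positivity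
    have hE : IsEquilibrium T D 0 (0, 0) := isEquilibrium_zero_iff.2 rfl
    refine ⟨1, hE, ?_, fun _ => hd, ?_⟩
    · intro j hj
      fin_cases j
      · exact absurd hE (hj _ (Or.inl hP.zero_mem_gam))
      · rfl
      · obtain ⟨p, hp, hpe⟩ := hj
        obtain ⟨e1, e2⟩ := isEquilibrium_iff.1 hpe
        have hx : p.1 = 0 := (mul_eq_zero.1 e2).resolve_left hD
        rw [hx, mul_zero] at e1
        have : p = (0, 0) := Prod.ext hx e1.symm
        rw [this] at hp
        exact absurd hP.zero_mem_gam hp.1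
    · have := hP.hasPV_of_zero hD hω0 (hω hd)
      convert this using 1
      simp [d, mul_div_cancel₀]
  by_cases hcross : ∀ t ∈ Icc 0 τ, D * (Ψ t).1 - a ≠ 0
  · have hno := fun p hp hpe =>
      hP.equilibrium_notMem_of_not_crossing ha hcross (p := p) hpe hp
    refine ⟨0, hno, ?_, fun h => absurd rfl h, ?_⟩
    · intro j hj
      fin_cases j
      · rfl
      · exact absurd (isEquilibrium_zero_iff.1 hj) ha
      · obtain ⟨p, hp, hpe⟩ := hj
        exact absurd hpe (hno p (Or.inr hp))
    · simpa [d] using hP.hasPV_of_not_crossing ha hcross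
  · push Not at hcross
    obtain ⟨t, ht, htc⟩ := hcross
    have htc' : D * (Ψ t).1 = a := sub_eq_zero.1 htc
    have hd := hP.disc_pos_of_crossing ha ht htc'
    have hD : 0 < D := by nlinarith [sq_nonneg T]
    have ha' : a < 0 := lt_of_le_of_ne
      (by rw [← htc']; exact mul_nonpos_of_nonneg_of_nonpos hD.le (hP.fst_nonpos ht)) ha
    have hω0 : 0 < √(4 * D - T ^ 2) / 2 := by have := Real.sqrt_pos.2 hd; positivity
    have hτ := hP.flight_time_of_crossing hD ha' hω0 (hω hd) rfl ht htc'
    have hmem := hP.mem_jordanInt_of_flight_time hD ha' hω0 (hω hd) rfl hτ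
    have hE : IsEquilibrium T D a (a / D, a * T / D) :=
      isEquilibrium_iff.2 ⟨by simp only; ring, by simp only; field_simp⟩
    refine ⟨2, ⟨_, hmem, hE⟩, ?_, fun _ => hd, ?_⟩
    · intro j hj
      fin_cases j
      · exact absurd hE (hj _ (Or.inr hmem))
      · exact absurd (isEquilibrium_zero_iff.1 hj) ha
      · rfl
    · have := hP.hasPV_of_flight_time hD ha' hω0 (hω hd) rfl hτ
      convert this using 1
      simp [d, mul_div_cancel₀]
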